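/- Let $d\ge 1$ and let $A_1,\ldots,A_m$ be Hermitian positive semidefinite matrices in $\mathbb{C}^{d\times d}$ with $\sum_{i=1}^m A_i=I$ and $\operatorname{tr}(A_i)\le\epsilon$ for every $i$, where $\epsilon\in\mathbb{R}$. Let $$\mu[A_1,\ldots,A_m](x)=\left(\prod_{i=1}^m\left(1-\frac{\partial}{\partial z_i}\right)\right)\det\left(xI+\sum_{i=1}^m z_iA_i\right)\Bigg|_{z_1=\cdots=z_m=0}$$ be their mixed characteristic polynomial. Then all complex roots of $\mu[A_1,\ldots,A_m]$ are real, it has a largest root, and this largest root is at most $(1+\sqrt{\epsilon})^2$. -/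

import Mathlib

open scoped ComplexOrder

/-- The polynomial `det (x I + ∑ i, z i • A i)`, as a polynomial in the variables `z i` with
coefficients in `ℂ[x]`. -/
noncomputable def mixedDet {d m : ℕ} (A : Fin m → Matrix (Fin d) (Fin d) ℂ) :
    MvPolynomial (Fin m) (Polynomial ℂ) :=
  Matrix.det
    ((MvPolynomial.C Polynomial.X : MvPolynomial (Fin m) (Polynomial ℂ)) •
        (1 : Matrix (Fin d) (Fin d) (MvPolynomial (Fin m) (Polynomial ℂ)))
      + ∑ i, (MvPolynomial.X i : MvPolynomial (Fin m) (Polynomial ℂ)) •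
          (A i).map (fun a => MvPolynomial.C (Polynomial.C a)))

/-- The operator `1 - ∂/∂z i` on polynomials in the variables `z`. -/
noncomputable def oneSubPartial {m : ℕ} (i : Fin m) :
    Module.End (Polynomial ℂ) (MvPolynomial (Fin m) (Polynomial ℂ)) :=
  1 - (MvPolynomial.pderiv i).toLinearMap

/-- The mixed characteristic polynomial
`μ[A₁, …, Aₘ](x) = (∏ i, (1 - ∂/∂z i)) det (x I + ∑ i, z i • A i)` at `z = 0`.
(The operators commute, so the order in the product does not matter.) -/
noncomputable def mixedCharPoly {d m : ℕ} (A : Fin m → Matrix (Fin d) (Fin d) ℂ) :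
    Polynomial ℂ :=
  MvPolynomial.eval (fun _ => 0) ((List.ofFn (fun i : Fin m => oneSubPartial i)).prod (mixedDet A))

/-! This is the multivariate barrier argument of Marcus, Spielman and Srivastava. Since `∑ A i = 1`,
the determinant in the definition is `p(z + x)` with `p(z) = det(∑ z i • A i)`, so `μ(x)` is `∏ (1 -
∂ᵢ) p` on the diagonal point `(x, …, x)`. Everything rests on zero-freeness in the region where each
coordinate is in the open upper half plane or on a real ray `[x k, ∞)`. This one condition encodes
both real stability and being above the roots, so it yields real-rootedness and the root bound
together.

Positive semidefiniteness makes `p` zero-free above `(t, …, t)` for every `t > 0`, and its barrier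
`Φᵢ = ∂ᵢp / p` there is `tr (A i) / t`. If `Φⱼ ≤ 1 - 1/δ`, then applying `1 - ∂ⱼ` and moving up by
`δ` in direction `j` keeps the polynomial zero-free and no `Φᵢ` increases (`barrier_sub_pderiv_le`).
With `t = √ε + ε` and `δ = 1 + √ε`, using each variable once ends at `t + δ = (1 + √ε)²`.

The step needs `Φᵢ` decreasing and convex in each variable. In one variable it is a rational
function sending the upper half plane to the closed lower one, hence `a - b z + ∑ c r / (z - r)`
with `b, c r ≥ 0` (`exists_nevanlinna`). -/

/-! ### Rational functions from the upper to the closed lower half plane -/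

open Polynomial Filter in
/-- If `Im L` is bounded above far out on a ray through `ω`, then the top coefficient of `L` along
this ray has nonpositive imaginary part. -/
theorem leadingCoeff_mul_im_pow_nonpos (L : ℝ[X]) (hn : 0 < L.natDegree) (ω : ℂ) {R M : ℝ}
    (h : ∀ t : ℝ, R ≤ t → (aeval ((t : ℂ) * ω) L).im ≤ M) :
    L.leadingCoeff * (ω ^ L.natDegree).im ≤ 0 := by
  set n := L.natDegree with hn_def
  set S : ℝ[X] := ∑ k ∈ Finset.range (n + 1), C (L.coeff k * (ω ^ k).im) * X ^ k with hS
  have hcoeff : S.coeff n = L.leadingCoeff * (ω ^ n).im := by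
    simp only [hS, finsetSum_coeff, coeff_C_mul, coeff_X_pow, leadingCoeff, ← hn_def]
    simp
  have heval (t : ℝ) : S.eval t = (aeval ((t : ℂ) * ω) L).im := by
    rw [aeval_eq_sum_range, hS, eval_finsetSum, Complex.im_sum]
    refine Finset.sum_congr rfl fun k _ => ?_
    have : L.coeff k • ((t : ℂ) * ω) ^ k = ((L.coeff k * t ^ k : ℝ) : ℂ) * ω ^ k := by
      rw [mul_pow, Complex.real_smul]; push_cast; ring
    rw [this, Complex.im_ofReal_mul]
    simp only [eval_mul, eval_C, eval_pow, eval_X]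
    ring
  by_contra hpos
  rw [← hcoeff, not_le] at hpos
  have hdeg : S.natDegree = n := by
    refine le_antisymm (natDegree_sum_le_of_forall_le _ _ fun k hk => ?_)
      (le_natDegree_of_ne_zero hpos.ne')
    exact (natDegree_C_mul_X_pow_le _ _).trans (Nat.lt_succ_iff.1 (Finset.mem_range.1 hk))
  have ht := S.tendsto_atTop_of_leadingCoeff_nonneg (natDegree_pos_iff_degree_pos.1 (hdeg ▸ hn))
    (by rw [leadingCoeff, hdeg]; exact hpos.le)
  obtain ⟨t, h1, h2⟩ := ((ht.eventually_gt_atTop M).and (eventually_ge_atTop R)).exists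
  exact (h1.trans_le ((heval t).trans_le (h t h2))).false

open Polynomial in
/-- A real polynomial whose imaginary part is bounded above near infinity in the upper half plane
is affine, with nonpositive slope. -/
theorem eq_affine_of_im_le (L : ℝ[X]) {R M : ℝ}
    (h : ∀ w : ℂ, 0 < w.im → R ≤ ‖w‖ → (aeval w L).im ≤ M) :
    ∃ a b : ℝ, 0 ≤ b ∧ L = C a - C b * X := by
  rcases Nat.eq_zero_or_pos L.natDegree with h0 | hn
  · exact ⟨L.coeff 0, 0, le_rfl, by simpa using eq_C_of_natDegree_eq_zero h0⟩
  have hn' : (0 : ℝ) < L.natDegree := by exact_mod_cast hn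
  have key (θ : ℝ) (h0 : 0 < θ) (hθ : θ < Real.pi) :
      L.leadingCoeff * Real.sin (L.natDegree * θ) ≤ 0 := by
    have := leadingCoeff_mul_im_pow_nonpos L hn (Complex.exp (θ * Complex.I)) (R := max R 1)
      (M := M) fun t ht => h _ ?_ ?_
    · rwa [← Complex.exp_nat_mul, ← mul_assoc, ← Complex.ofReal_natCast, ← Complex.ofReal_mul,
        Complex.exp_ofReal_mul_I_im] at this
    · rw [Complex.im_ofReal_mul, Complex.exp_ofReal_mul_I_im]
      exact mul_pos (zero_lt_one.trans_le ((le_max_right _ _).trans ht))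
        (Real.sin_pos_of_pos_of_lt_pi h0 hθ)
    · rw [norm_mul, Complex.norm_exp_ofReal_mul_I, mul_one, Complex.norm_real]
      exact ((le_max_left _ _).trans ht).trans (le_abs_self t)
  have h1 : L.leadingCoeff ≤ 0 := by
    -- The angle `π / (2n)` makes the sine `1`. If `n ≥ 2`, then `3π / (2n)` is still below `π` and
    -- makes it `-1`, which forces a zero leading coefficient.
    have := key (Real.pi / 2 / L.natDegree) (by positivity) ?_
    · rwa [mul_div_cancel₀ _ hn'.ne', Real.sin_pi_div_two, mul_one] at this
    · rw [div_lt_iff₀ hn']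
      have : (1 : ℝ) ≤ L.natDegree := by exact_mod_cast hn
      nlinarith [Real.pi_pos]
  have hle : L.natDegree ≤ 1 := by
    by_contra hgt
    have h2 : (2 : ℝ) ≤ L.natDegree := by exact_mod_cast not_le.1 hgt
    have := key ((Real.pi / 2 + Real.pi) / L.natDegree) (by positivity) ?_
    · rw [mul_div_cancel₀ _ hn'.ne', Real.sin_add_pi, Real.sin_pi_div_two] at this
      have h3 : L.leadingCoeff = 0 := by linarith
      rw [leadingCoeff_eq_zero] at h3
      simp [h3] at hn
    · rw [div_lt_iff₀ hn']
      nlinarith [Real.pi_pos]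
  have h1' : L.natDegree = 1 := le_antisymm hle hn
  refine ⟨L.coeff 0, -L.coeff 1, ?_, ?_⟩
  · rw [leadingCoeff, h1'] at h1
    linarith
  · conv_lhs => rw [eq_X_add_C_of_natDegree_le_one hle]
    simp only [map_neg]; ring

open Polynomial in
/-- Partial fractions for a split denominator, with polar parts written as polynomials in
`1 / (r - z)`. -/
theorem exists_partialFractions (P Q : ℝ[X]) (hP : P.Splits) (hP0 : P ≠ 0) :
    ∃ (q : ℝ[X]) (L : ℝ → ℝ[X]), ∀ z : ℂ, aeval z P ≠ 0 →
      aeval z Q / aeval z P =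
        aeval z q + ∑ r ∈ P.roots.toFinset, aeval (1 / ((r : ℂ) - z)) (L r) := by
  classical
  obtain ⟨q, c, hc, hQ⟩ := eq_quo_mul_prod_pow_add_sum_rem_mul_prod_pow (s := P.roots.toFinset) Q
    (g := fun r => X - C r) (fun r _ => monic_X_sub_C r)
    (fun i _ j _ hij => pairwise_coprime_X_sub_C (s := id) Function.injective_id hij)
    (fun r => P.roots.count r)
  have hl : P.leadingCoeff ≠ 0 := leadingCoeff_ne_zero.2 hP0
  have hPe : P = C P.leadingCoeff * ∏ r ∈ P.roots.toFinset, (X - C r) ^ P.roots.count r := by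
    conv_lhs => rw [hP.eq_prod_roots]
    rw [Finset.prod_multiset_map_count]
  set lc := P.leadingCoeff
  set s := P.roots.toFinset
  set n := fun r => P.roots.count r
  -- Each remainder `c r j` is constant, its degree being below that of `X - C r`. Its term
  -- contributes `(z - r) ^ (j - n r)`, a power of `-1 / (r - z)`. The variable `1 / (r - z)` is
  -- chosen because it preserves the upper half plane.
  refine ⟨C lc⁻¹ * q, fun r => C lc⁻¹ * ∑ j : Fin (n r),
    C ((c r j).coeff 0) * (-X) ^ (n r - j), fun z hz => ?_⟩
  set v : ℂ := ∏ r ∈ s, (z - r) ^ n r with hv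
  have hPz : aeval z P = lc * v := by
    rw [hPe]; simp [hv, n]
  have hlc : (lc : ℂ) ≠ 0 := by exact_mod_cast hl
  have hv0 : v ≠ 0 := fun h => hz (by rw [hPz, h, mul_zero])
  rw [div_eq_iff hz, hPz]
  have hterm (r : ℝ) (hr : r ∈ s) (j : Fin (n r)) :
      aeval z (c r j * (X - C r) ^ (j : ℕ) * ∏ k ∈ s.erase r, (X - C k) ^ n k) =
        ((c r j).coeff 0 : ℂ) * (-(1 / ((r : ℂ) - z))) ^ (n r - j) * v := by
    have hnr : n r ≠ 0 := Nat.ne_zero_of_lt j.2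
    have hzr : z - r ≠ 0 := by
      intro h0
      exact hv0 (Finset.prod_eq_zero hr (by rw [h0, zero_pow hnr]))
    have hC : c r j = C ((c r j).coeff 0) := by
      apply eq_C_of_degree_le_zero
      have := hc r hr j
      rw [degree_X_sub_C] at this
      exact Nat.WithBot.lt_one_iff_le_zero.mp this
    rw [hv, ← Finset.mul_prod_erase s _ hr, hC]
    have hinv : -(1 / ((r : ℂ) - z)) = (z - r)⁻¹ := by
      rw [← neg_sub z, one_div, inv_neg, neg_neg]
    have hpow : (z - r) ^ n r = (z - r) ^ (n r - j) * (z - r) ^ (j : ℕ) := by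
      rw [← pow_add, Nat.sub_add_cancel j.2.le]
    rw [hinv, hpow, inv_pow]
    simp only [map_mul, map_pow, map_sub, aeval_X, aeval_C, map_prod, Complex.coe_algebraMap,
      coeff_C_zero]
    field_simp
  conv_lhs => rw [hQ]
  rw [map_add, map_mul, map_sum, add_mul, map_mul]
  have h1 : aeval z (∏ r ∈ s, (X - C r : ℝ[X]) ^ n r) = v := by simp [hv]
  rw [h1, aeval_C, Complex.coe_algebraMap]
  congr 1
  · push_cast; field_simp
  · rw [Finset.sum_mul]
    refine Finset.sum_congr rfl fun r hr => ?_
    rw [map_sum, Finset.sum_congr rfl fun j _ => hterm r hr j]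
    simp only [map_mul, map_sum, map_pow, map_neg, aeval_X, aeval_C, Complex.coe_algebraMap]
    rw [← Finset.sum_mul]
    push_cast; field_simp

open Polynomial in
/-- A rational function with split denominator that maps the upper half plane to the closed lower
half plane is `a - b z + ∑ c r / (z - r)` with `b, c r ≥ 0`. -/
theorem exists_nevanlinna (P Q : ℝ[X]) (hP : P.Splits) (hP0 : P ≠ 0)
    (hPne : ∀ z : ℂ, 0 < z.im → aeval z P ≠ 0)
    (him : ∀ z : ℂ, 0 < z.im → (aeval z Q / aeval z P).im ≤ 0) :
    ∃ (a b : ℝ) (c : ℝ → ℝ), 0 ≤ b ∧ (∀ r, 0 ≤ c r) ∧ ∀ x : ℝ, P.eval x ≠ 0 →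
      Q.eval x / P.eval x = a - b * x + ∑ r ∈ P.roots.toFinset, c r / (x - r) := by
  classical
  obtain ⟨q, L, hqL⟩ := exists_partialFractions P Q hP hP0
  set s := P.roots.toFinset
  have hLc (r : ℝ) : Continuous fun w : ℂ => aeval w (L r) := (L r).continuous_aeval
  -- Near infinity the polar parts converge, so `Im q` is bounded above there.
  have hq : ∃ a b : ℝ, 0 ≤ b ∧ q = C a - C b * X := by
    have hlim : Filter.Tendsto (fun z : ℂ => ∑ r ∈ s, aeval (1 / ((r : ℂ) - z)) (L r))
        (Bornology.cobounded ℂ) (nhds (∑ r ∈ s, aeval (0 : ℂ) (L r))) := by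
      refine tendsto_finsetSum _ fun r _ => ((hLc r).tendsto 0).comp ?_
      simp only [one_div]
      exact Filter.tendsto_inv₀_cobounded.comp (tendsto_const_sub_cobounded _)
    have hev := ((Complex.continuous_im.tendsto _).comp hlim).eventually_const_lt
      (sub_one_lt (∑ r ∈ s, aeval (0 : ℂ) (L r)).im)
    rw [← comap_norm_atTop, Filter.eventually_comap, Filter.eventually_atTop] at hev
    obtain ⟨R, hR⟩ := hev
    refine eq_affine_of_im_le q (R := R) (M := -((∑ r ∈ s, aeval (0 : ℂ) (L r)).im - 1))
      fun w hw hRw => ?_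
    have h1 := hR _ hRw w rfl
    have h2 := him w hw
    rw [hqL w (hPne w hw), Complex.add_im] at h2
    simp only [Function.comp_apply] at h1
    linarith
  -- Near a pole, put `z = r - 1 / w`: large `w` in the upper half plane correspond to `z` near `r`
  -- in it, where all other terms stay bounded.
  have hL (r : ℝ) : ∃ a b : ℝ, 0 ≤ b ∧ (r ∈ s → L r = C a - C b * X) := by
    by_cases hr : r ∈ s
    swap
    · exact ⟨0, 0, le_rfl, fun h => absurd h hr⟩
    set g : ℂ → ℂ := fun z => aeval z q + ∑ k ∈ s.erase r, aeval (1 / ((k : ℂ) - z)) (L k)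
    have hg : ContinuousAt g r := by
      refine (q.continuous_aeval.continuousAt).add (tendsto_finsetSum _ fun k hk => ?_)
      refine ((hLc k).continuousAt).comp
        (ContinuousAt.div continuousAt_const (continuousAt_const.sub continuousAt_id) ?_)
      have := Finset.ne_of_mem_erase hk
      simpa [sub_eq_zero] using this
    have hlim : Filter.Tendsto (fun w : ℂ => g (r - 1 / w)) (Bornology.cobounded ℂ)
        (nhds (g r)) := by
      refine hg.tendsto.comp ?_
      simpa using (tendsto_const_nhds (x := (r : ℂ))).sub
        (Filter.tendsto_inv₀_cobounded (α := ℂ))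
    have hev := ((Complex.continuous_im.tendsto _).comp hlim).eventually_const_lt
      (sub_one_lt (g r).im)
    rw [← comap_norm_atTop, Filter.eventually_comap, Filter.eventually_atTop] at hev
    obtain ⟨R, hR⟩ := hev
    obtain ⟨a, b, hb, h⟩ := eq_affine_of_im_le (L r) (R := R) (M := -((g r).im - 1))
      fun w hw hRw => by
        have h1 := hR _ hRw w rfl
        have hz : 0 < ((r : ℂ) - 1 / w).im := by
          have : 0 < Complex.normSq w := Complex.normSq_pos.2 (by rintro rfl; simp at hw)
          simp only [Complex.sub_im, Complex.ofReal_im, one_div, Complex.inv_im]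
          rw [zero_sub, neg_div, neg_neg]
          positivity
        have h2 := him _ hz
        rw [hqL _ (hPne _ hz), ← Finset.add_sum_erase s _ hr, sub_sub_cancel, one_div_one_div,
          add_left_comm, Complex.add_im] at h2
        simp only [Function.comp_apply, g] at h1
        linarith
    exact ⟨a, b, hb, fun _ => h⟩
  obtain ⟨a, b, hb, rfl⟩ := hq
  choose a' c hc hL using hL
  refine ⟨a + ∑ r ∈ s, a' r, b, c, hb, hc, fun x hx => ?_⟩
  have hx' : aeval (x : ℂ) P ≠ 0 := by
    rw [show (x : ℂ) = algebraMap ℝ ℂ x from rfl, aeval_algebraMap_apply]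
    simpa using hx
  have h := hqL x hx'
  rw [show (x : ℂ) = algebraMap ℝ ℂ x from rfl, aeval_algebraMap_apply,
    aeval_algebraMap_apply] at h
  have hsum : ∑ r ∈ s, aeval (1 / ((r : ℂ) - algebraMap ℝ ℂ x)) (L r) =
      ((∑ r ∈ s, (a' r + c r / (x - r)) : ℝ) : ℂ) := by
    push_cast
    refine Finset.sum_congr rfl fun r hr => ?_
    rw [hL r hr]
    simp only [map_sub, map_mul, aeval_C, aeval_X, Complex.coe_algebraMap]
    rw [← neg_sub (x : ℂ), one_div, inv_neg, mul_neg, sub_neg_eq_add, div_eq_mul_inv]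
  rw [hsum] at h
  simp only [map_sub, map_mul, aeval_C, aeval_X, Complex.coe_algebraMap,
    Polynomial.coe_aeval_eq_eval] at h
  have h' : Q.eval x / P.eval x = a - b * x + ∑ r ∈ s, (a' r + c r / (x - r)) := by
    exact_mod_cast h
  rw [h', Finset.sum_add_distrib]
  ring

open Polynomial in
/-- A real polynomial without nonreal roots splits. -/
theorem splits_of_aeval_ne_zero (P : ℝ[X]) (h : ∀ z : ℂ, 0 < z.im → aeval z P ≠ 0) :
    P.Splits := by
  refine Splits.of_splits_map (algebraMap ℝ ℂ) (IsAlgClosed.splits _) fun z hz => ?_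
  have hz0 : aeval z P = 0 := by
    rw [mem_roots', IsRoot, eval_map_algebraMap] at hz
    exact hz.2
  refine ⟨z.re, Complex.ext (by simp) ?_⟩
  rcases lt_trichotomy z.im 0 with hlt | h0 | hgt
  · refine absurd ?_ (h (starRingEnd ℂ z) (by simpa using hlt))
    rw [aeval_conj, hz0, map_zero]
  · simpa using h0.symm
  · exact absurd hz0 (h z hgt)

open Polynomial in
/-- Monotonicity and convexity, to the right of the poles, of a rational function that maps the
upper half plane to the closed lower half plane. -/
theorem div_antitone_and_tangent_le (P Q : ℝ[X]) {x y : ℝ} (hxy : x ≤ y)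
    (hPne : ∀ z : ℂ, 0 < z.im → aeval z P ≠ 0) (hPx : ∀ t : ℝ, x ≤ t → P.eval t ≠ 0)
    (him : ∀ z : ℂ, 0 < z.im → (aeval z Q / aeval z P).im ≤ 0) :
    Q.eval y / P.eval y ≤ Q.eval x / P.eval x ∧
    ((derivative Q).eval y * P.eval y - Q.eval y * (derivative P).eval y) / P.eval y ^ 2 ≤ 0 ∧
    (x - y) * (((derivative Q).eval y * P.eval y - Q.eval y * (derivative P).eval y) /
      P.eval y ^ 2) ≤ Q.eval x / P.eval x - Q.eval y / P.eval y := by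
  have hP0 : P ≠ 0 := by
    rintro rfl
    exact hPx x le_rfl eval_zero
  obtain ⟨a, b, c, hb, hc, hf⟩ := exists_nevanlinna P Q (splits_of_aeval_ne_zero P hPne) hP0
    hPne him
  set s := P.roots.toFinset with hs
  have hroot (r : ℝ) (hr : r ∈ s) : r < x := by
    by_contra hle
    exact hPx r (not_lt.1 hle) (by simpa [hs, hP0] using hr)
  set D := ((derivative Q).eval y * P.eval y - Q.eval y * (derivative P).eval y) / P.eval y ^ 2
  -- `D` is the derivative of `Q / P` at `y`; by uniqueness of derivatives it can be read off the
  -- partial fractions.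
  have hD : D = -b + ∑ r ∈ s, -(c r / (y - r) ^ 2) := by
    have h1 : HasDerivAt (fun t => Q.eval t / P.eval t) D y :=
      (Q.hasDerivAt y).div (P.hasDerivAt y) (hPx y hxy)
    have h2 : HasDerivAt (fun t => a - b * t + ∑ r ∈ s, c r / (t - r))
        (-b + ∑ r ∈ s, -(c r / (y - r) ^ 2)) y := by
      refine HasDerivAt.add ?_ (HasDerivAt.fun_sum fun r hr => ?_)
      · simpa using ((hasDerivAt_id y).const_mul b).const_sub a
      · have hne : y - r ≠ 0 := (sub_pos.2 ((hroot r hr).trans_le hxy)).ne'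
        have := (((hasDerivAt_id y).sub_const r).inv hne).const_mul (c r)
        simpa [div_eq_mul_inv, neg_div] using this
    refine h1.unique (h2.congr_of_eventuallyEq ?_)
    filter_upwards [P.continuous.continuousAt.eventually_ne (hPx y hxy)] with t ht using hf t ht
  have hD0 : D ≤ 0 := by
    rw [hD]
    have : ∑ r ∈ s, -(c r / (y - r) ^ 2) ≤ 0 :=
      Finset.sum_nonpos fun r _ => neg_nonpos.2 (div_nonneg (hc r) (sq_nonneg _))
    linarith
  have htan : (x - y) * D ≤ Q.eval x / P.eval x - Q.eval y / P.eval y := by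
    rw [hf x (hPx x le_rfl), hf y (hPx y hxy), hD, mul_add, Finset.mul_sum]
    have : ∑ r ∈ s, (x - y) * -(c r / (y - r) ^ 2) ≤
        ∑ r ∈ s, (c r / (x - r) - c r / (y - r)) := by
      refine Finset.sum_le_sum fun r hr => ?_
      have hx : 0 < x - r := sub_pos.2 (hroot r hr)
      have hy : 0 < y - r := hx.trans_le (sub_le_sub_right hxy r)
      have : c r / (x - r) - c r / (y - r) - (x - y) * -(c r / (y - r) ^ 2) =
          c r * (x - y) ^ 2 / ((x - r) * (y - r) ^ 2) := by
        field_simp; ring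
      have h2 : 0 ≤ c r * (x - y) ^ 2 / ((x - r) * (y - r) ^ 2) := by
        have := hc r
        positivity
      linarith
    rw [Finset.sum_sub_distrib] at this
    linarith
  refine ⟨?_, hD0, htan⟩
  have := mul_nonneg_of_nonpos_of_nonpos (sub_nonpos.2 hxy) hD0
  linarith

open Polynomial in
/-- If `Q / P` maps the upper half plane to the closed lower half plane and takes the value `1`
there, then `Q = P`. -/
theorem eq_of_im_div_nonpos (P Q : ℂ[X]) (hPne : ∀ z : ℂ, 0 < z.im → P.eval z ≠ 0)
    (him : ∀ z : ℂ, 0 < z.im → (Q.eval z / P.eval z).im ≤ 0) {w : ℂ} (hw : 0 < w.im)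
    (h : Q.eval w = P.eval w) : Q = P := by
  set U : Set ℂ := {z | 0 < z.im} with hU
  have hUo : IsOpen U := isOpen_lt continuous_const Complex.continuous_im
  have han : AnalyticOnNhd ℂ (fun z => Q.eval z / P.eval z) U := fun z hz =>
    (AnalyticOnNhd.eval_polynomial Q z trivial).div (AnalyticOnNhd.eval_polynomial P z trivial)
      (hPne z hz)
  have hw1 : Q.eval w / P.eval w = 1 := by rw [h, div_self (hPne w hw)]
  -- Open mapping: were `Q / P` not constant, its image would contain `1 + t * I` for small `t > 0`.
  rcases han.is_constant_or_isOpen (convex_halfSpace_im_gt 0).isPreconnected with ⟨v, hv⟩ | hopen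
  · have hv1 : v = 1 := (hv w hw).symm.trans hw1
    refine eq_of_infinite_eval_eq Q P (Set.Infinite.mono (s := U) (fun z hz => ?_) ?_)
    · have := hv z hz
      rw [hv1, div_eq_one_iff_eq (hPne z hz)] at this
      exact this
    · exact infinite_of_mem_nhds w (hUo.mem_nhds hw)
  · exfalso
    have hmem := (hopen U subset_rfl hUo).mem_nhds ⟨w, hw, hw1⟩
    have hcont : Filter.Tendsto (fun t : ℝ => (1 : ℂ) + t * Complex.I) (nhdsWithin 0 (Set.Ioi 0))
        (nhds 1) := by
      have : Continuous fun t : ℝ => (1 : ℂ) + t * Complex.I := by fun_prop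
      simpa using (this.tendsto 0).mono_left nhdsWithin_le_nhds
    obtain ⟨t, ⟨z, hz, hzt⟩, ht⟩ := ((hcont.eventually hmem).and self_mem_nhdsWithin).exists
    have := him z hz
    simp only at hzt
    rw [hzt] at this
    simp at this
    exact absurd ht (not_lt.2 this)

/-! ### Zero-free regions and barrier functions -/

namespace MvPolynomial

variable {σ : Type*}

theorem pderiv_pderiv_comm {R : Type*} [CommRing R] (i j : σ) (p : MvPolynomial σ R) :
    pderiv i (pderiv j p) = pderiv j (pderiv i p) := by
  classical
  ext m
  by_cases h : i = j
  · rw [h]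
  · have h' : j ≠ i := Ne.symm h
    simp only [coeff_pderiv, Finsupp.add_apply, Finsupp.single_apply, h, h', if_false, add_zero,
      add_right_comm m (Finsupp.single i 1)]
    ring

section Slice

variable [DecidableEq σ] {R A : Type*} [CommRing R] [CommRing A] [Algebra R A]

/-- The univariate polynomial obtained from a multivariate one by fixing all variables except the
`j`-th to the values `x`. -/
noncomputable def slice (x : σ → A) (j : σ) : MvPolynomial σ R →ₐ[R] Polynomial A :=
  aeval (Function.update (fun k => Polynomial.C (x k)) j Polynomial.X)

theorem aeval_slice {B : Type*} [CommRing B] [Algebra R B] [Algebra A B] [IsScalarTower R A B]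
    (x : σ → A) (j : σ) (p : MvPolynomial σ R) (t : B) :
    Polynomial.aeval t (slice x j p) =
      aeval (Function.update (fun k => algebraMap A B (x k)) j t) p := by
  have : ((Polynomial.aeval (R := A) t).restrictScalars R).comp (slice x j) =
      aeval (R := R) (Function.update (fun k => algebraMap A B (x k)) j t) := by
    refine algHom_ext fun k => ?_
    by_cases hk : k = j
    · subst hk; simp [slice]
    · simp [slice, hk]
  exact DFunLike.congr_fun this p

theorem eval_slice (x : σ → A) (j : σ) (p : MvPolynomial σ R) (t : A) :
    (slice x j p).eval t = aeval (Function.update x j t) p := by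
  simpa using aeval_slice x j p t

theorem derivative_slice (x : σ → A) (j : σ) (p : MvPolynomial σ R) :
    Polynomial.derivative (slice x j p) = slice x j (pderiv j p) := by
  induction p using MvPolynomial.induction_on with
  | C a => simp [slice, IsScalarTower.algebraMap_apply R A (Polynomial A)]
  | add p q hp hq => simp only [map_add, hp, hq]
  | mul_X p k hp =>
    rw [map_mul, Polynomial.derivative_mul, hp, Derivation.leibniz, pderiv_X]
    by_cases hk : k = j
    · subst hk
      simp [slice]; ring
    · simp [slice, hk]; ring

end Slice

/-- The points all of whose coordinates lie in the open upper half plane or on the real ray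
starting at `x k`. -/
def upperRegion (x : σ → ℝ) : Set (σ → ℂ) :=
  {z | ∀ k, 0 < (z k).im ∨ ((z k).im = 0 ∧ x k ≤ (z k).re)}

theorem upperRegion_anti {x y : σ → ℝ} (h : x ≤ y) : upperRegion y ⊆ upperRegion x :=
  fun _ hz k => (hz k).imp_right fun hk => ⟨hk.1, (h k).trans hk.2⟩

theorem ofReal_mem_upperRegion {x y : σ → ℝ} (h : x ≤ y) :
    (fun k => (y k : ℂ)) ∈ upperRegion x :=
  fun k => Or.inr ⟨Complex.ofReal_im _, by simpa using h k⟩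

theorem update_mem_upperRegion [DecidableEq σ] {x : σ → ℝ} {z : σ → ℂ} (hz : z ∈ upperRegion x)
    (j : σ) {w : ℂ} (hw : 0 < w.im ∨ (w.im = 0 ∧ x j ≤ w.re)) :
    Function.update z j w ∈ upperRegion x := by
  intro k
  by_cases hk : k = j
  · subst hk; simpa using hw
  · simpa [hk] using hz k

/-- `p` has no zeros in the region of points with coordinates in the upper half plane or on the
rays starting at `x k`. -/
def NonvanishingAbove (p : MvPolynomial σ ℝ) (x : σ → ℝ) : Prop :=
  ∀ z ∈ upperRegion x, aeval z p ≠ 0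

/-- The logarithmic derivative of `p` in the variable `i`. -/
noncomputable def barrier (p : MvPolynomial σ ℝ) (i : σ) (x : σ → ℝ) : ℝ :=
  aeval x (pderiv i p) / aeval x p

theorem aeval_ofReal (p : MvPolynomial σ ℝ) (x : σ → ℝ) :
    aeval (fun k => (x k : ℂ)) p = ((aeval x p : ℝ) : ℂ) := by
  have := aeval_algebraMap_apply (A := ℝ) ℂ x p
  simpa [Function.comp_def] using this

namespace NonvanishingAbove

variable {p : MvPolynomial σ ℝ} {x : σ → ℝ}

theorem aeval_real_ne_zero (hp : NonvanishingAbove p x) {y : σ → ℝ} (hy : x ≤ y) :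
    aeval y p ≠ 0 := by
  have := hp _ (ofReal_mem_upperRegion hy)
  rw [aeval_ofReal] at this
  exact_mod_cast this

/-- In the variable `i` the logarithmic derivative is `∑ 1 / (z i - ρ)`, and zero-freeness puts
every root `ρ` in the closed lower half plane. -/
theorem im_logDeriv_nonpos (hp : NonvanishingAbove p x) {z : σ → ℂ} (hz : z ∈ upperRegion x)
    (i : σ) : (aeval z (pderiv i p) / aeval z p).im ≤ 0 := by
  classical
  have hP (w : ℂ) := eval_slice z i p w
  have hQ := eval_slice z i (pderiv i p) (z i)
  have hPz := hP (z i)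
  rw [Function.update_eq_self] at hPz hQ
  rw [← hPz, ← hQ, ← derivative_slice,
    (IsAlgClosed.splits (slice z i p)).eval_derivative_div_eval_of_ne_zero (hPz ▸ hp z hz)]
  rw [← Complex.imCLM_apply, map_multiset_sum, Multiset.map_map]
  refine Multiset.sum_induction (· ≤ 0) _ (fun _ _ => add_nonpos) le_rfl fun v hv => ?_
  obtain ⟨ρ, hρ, rfl⟩ := Multiset.mem_map.1 hv
  have hρ0 : aeval (Function.update z i ρ) p = 0 := by
    rw [← hP]; exact (Polynomial.mem_roots'.1 hρ).2
  have h1 : ρ.im ≤ 0 := by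
    by_contra hlt
    exact hp _ (update_mem_upperRegion hz i (Or.inl (not_le.1 hlt))) hρ0
  have h2 : 0 ≤ (z i).im := (hz i).elim le_of_lt fun h => h.1.ge
  simp only [Function.comp_apply, Complex.imCLM_apply, one_div, Complex.inv_im,
    Complex.sub_im]
  exact div_nonpos_of_nonpos_of_nonneg (by linarith) (Complex.normSq_nonneg _)

/-- Slicing along `k` reduces this to one variable; `D` is the partial derivative of the barrier in
direction `k`, and the last inequality is convexity. -/
theorem update_antitone_and_tangent_le [DecidableEq σ] (hp : NonvanishingAbove p x) {u : σ → ℝ}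
    (hu : x ≤ u) (i k : σ) {t : ℝ} (ht : u k ≤ t) {v : σ → ℝ} (hv : v = Function.update u k t)
    {D : ℝ} (hD : D = (aeval v (pderiv k (pderiv i p)) * aeval v p -
      aeval v (pderiv i p) * aeval v (pderiv k p)) / (aeval v p) ^ 2) :
    barrier p i v ≤ barrier p i u ∧ D ≤ 0 ∧ (u k - t) * D ≤ barrier p i u - barrier p i v := by
  subst hv hD
  have hmem (z : ℂ) (hz : 0 < z.im) :
      Function.update (fun l => (u l : ℂ)) k z ∈ upperRegion x :=
    update_mem_upperRegion (ofReal_mem_upperRegion hu) k (Or.inl hz)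
  have hC (q : MvPolynomial σ ℝ) (z : ℂ) : Polynomial.aeval z (slice u k q) =
      aeval (Function.update (fun l => (u l : ℂ)) k z) q := aeval_slice u k q z
  have := div_antitone_and_tangent_le (slice u k p) (slice u k (pderiv i p)) ht
    (fun z hz => by rw [hC]; exact hp _ (hmem z hz))
    (fun s hs => by
      rw [eval_slice]
      refine hp.aeval_real_ne_zero (hu.trans ?_)
      rw [le_update_iff]
      exact ⟨hs, fun _ _ => le_rfl⟩)
    (fun z hz => by rw [hC, hC]; exact hp.im_logDeriv_nonpos (hmem z hz) i)
  rw [derivative_slice, derivative_slice] at this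
  simpa only [eval_slice, Function.update_eq_self, barrier] using this

theorem barrier_antitone [Fintype σ] (hp : NonvanishingAbove p x) (i : σ) {y : σ → ℝ}
    (hy : x ≤ y) : barrier p i y ≤ barrier p i x := by
  classical
  have key (s : Finset σ) : barrier p i (s.piecewise y x) ≤ barrier p i x := by
    induction s using Finset.induction_on with
    | empty => simp
    | insert k s hk ih =>
      refine le_trans ?_ ih
      rw [Finset.piecewise_insert]
      refine (hp.update_antitone_and_tangent_le (Finset.le_piecewise_of_le_of_le s hy le_rfl)
        i k ?_ rfl rfl).1
      rw [Finset.piecewise_eq_of_notMem _ _ _ hk]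
      exact hy k
  simpa using key Finset.univ

/-- At a zero, `∂ⱼp / p = 1`. By `eq_of_im_div_nonpos` this identity persists along any coordinate
in the open half plane, so each such coordinate can be replaced by the real value `x k`. At the
resulting real point the `j`-th barrier is `1`, contradicting monotonicity. -/
theorem sub_pderiv [Fintype σ] (hp : NonvanishingAbove p x) (j : σ) (hj : barrier p j x < 1) :
    NonvanishingAbove (p - pderiv j p) x := by
  classical
  intro z hz h0
  have key (s : Finset σ) : ∃ z ∈ upperRegion x, aeval z (pderiv j p) = aeval z p ∧
      ∀ k ∈ s, (z k).im = 0 := by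
    induction s using Finset.induction_on with
    | empty => exact ⟨z, hz, by rw [map_sub, sub_eq_zero] at h0; exact h0.symm, by simp⟩
    | insert k s hk ih =>
      obtain ⟨z, hz, h1, hs⟩ := ih
      rcases hz k with hzk | hzk
      swap
      · exact ⟨z, hz, h1, fun l hl => (Finset.mem_insert.1 hl).elim (fun h => h ▸ hzk.1) (hs l)⟩
      have hmem (w : ℂ) (hw : 0 < w.im) := update_mem_upperRegion hz k (w := w) (Or.inl hw)
      have heq := eq_of_im_div_nonpos (slice z k p) (slice z k (pderiv j p))
        (fun w hw => by rw [eval_slice]; exact hp _ (hmem w hw))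
        (fun w hw => by
          rw [eval_slice, eval_slice]; exact hp.im_logDeriv_nonpos (hmem w hw) j)
        hzk (by rwa [eval_slice, eval_slice, Function.update_eq_self])
      refine ⟨Function.update z k (x k), update_mem_upperRegion hz k
        (Or.inr ⟨Complex.ofReal_im _, (Complex.ofReal_re _).ge⟩), ?_, fun l hl => ?_⟩
      · rw [← eval_slice, ← eval_slice, heq]
      · by_cases hlk : l = k
        · subst hlk; simp
        · simpa [hlk] using hs l ((Finset.mem_insert.1 hl).resolve_left hlk)
  obtain ⟨z, hz, h1, hs⟩ := key Finset.univ
  obtain ⟨y, rfl⟩ : ∃ y : σ → ℝ, z = fun k => (y k : ℂ) :=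
    ⟨fun k : σ => (z k).re, by
      funext k
      exact Complex.ext (by simp) (by simpa using hs k (Finset.mem_univ k))⟩
  have hy : x ≤ y := fun k => by simpa using hz k
  have hne := hp.aeval_real_ne_zero hy
  have h2 := hp.barrier_antitone j hy
  rw [aeval_ofReal, aeval_ofReal, Complex.ofReal_inj] at h1
  rw [barrier, h1, div_self hne] at h2
  exact (h2.trans_lt hj).false

theorem mono (hp : NonvanishingAbove p x) {y : σ → ℝ} (hy : x ≤ y) : NonvanishingAbove p y :=
  fun z hz => hp z (upperRegion_anti hy hz)

/-- Applying `1 - ∂/∂z j` and moving up by `δ` in the `j`-th direction does not increase the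
barrier functions. -/
theorem barrier_sub_pderiv_le [Fintype σ] [DecidableEq σ] (hp : NonvanishingAbove p x) {δ : ℝ}
    (hδ : 0 < δ) (i j : σ) (hj : barrier p j x ≤ 1 - 1 / δ) :
    NonvanishingAbove (p - pderiv j p) (Function.update x j (x j + δ)) ∧
      barrier (p - pderiv j p) i (Function.update x j (x j + δ)) ≤ barrier p i x := by
  set y := Function.update x j (x j + δ) with hy
  have hxy : x ≤ y := by
    rw [hy, le_update_iff]
    exact ⟨by linarith, fun _ _ => le_rfl⟩
  have hδ' : 0 < 1 / δ := by positivity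
  have hψ : barrier p j y ≤ 1 - 1 / δ := (hp.barrier_antitone j hxy).trans hj
  refine ⟨(hp.mono hxy).sub_pderiv j (by linarith), ?_⟩
  obtain ⟨-, hD, htan⟩ := hp.update_antitone_and_tangent_le le_rfl i j
    (show x j ≤ x j + δ by linarith) hy rfl
  set D := (aeval y (pderiv j (pderiv i p)) * aeval y p -
      aeval y (pderiv i p) * aeval y (pderiv j p)) / (aeval y p) ^ 2 with hDdef
  have hne := hp.aeval_real_ne_zero hxy
  have hcomm : pderiv i (pderiv j p) = pderiv j (pderiv i p) := pderiv_pderiv_comm i j p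
  have h1ψ : 0 < 1 - barrier p j y := by linarith
  -- Logarithmic derivative of `p * (1 - Φⱼ)`, with `D = ∂ⱼΦᵢ = ∂ᵢΦⱼ`. Then `1 / (1 - Φⱼ) ≤ δ` and
  -- the tangent inequality absorb the correction term.
  have hnew : barrier (p - pderiv j p) i y = barrier p i y - D / (1 - barrier p j y) := by
    have h1ψ' := h1ψ.ne'
    have hsub : aeval y p - aeval y (pderiv j p) ≠ 0 := by
      intro h0
      rw [barrier, ← sub_eq_zero.1 h0, div_self hne, sub_self] at h1ψ
      exact h1ψ.false
    rw [hDdef]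
    unfold barrier
    rw [map_sub, map_sub, map_sub, hcomm, one_sub_div hne]
    field_simp
    ring
  have hle : -D / (1 - barrier p j y) ≤ δ * -D := by
    rw [div_le_iff₀ h1ψ]
    have h3 : 1 ≤ δ * (1 - barrier p j y) := by
      have : δ * (1 / δ) ≤ δ * (1 - barrier p j y) :=
        mul_le_mul_of_nonneg_left (by linarith) hδ.le
      rwa [mul_one_div_cancel hδ.ne'] at this
    nlinarith
  rw [hnew]
  have : D / (1 - barrier p j y) = -(-D / (1 - barrier p j y)) := by ring
  linarith

/-- Iterating `barrier_sub_pderiv_le` over a list of distinct variables. -/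
theorem foldr_sub_pderiv [Fintype σ] [DecidableEq σ] (hp : NonvanishingAbove p x) {δ : ℝ}
    (hδ : 0 < δ) (hx : ∀ i, barrier p i x ≤ 1 - 1 / δ) (l : List σ) (hl : l.Nodup) :
    NonvanishingAbove (l.foldr (fun i q => q - pderiv i q) p)
        (fun k => if k ∈ l then x k + δ else x k) ∧
      ∀ i ∉ l, barrier (l.foldr (fun i q => q - pderiv i q) p) i
        (fun k => if k ∈ l then x k + δ else x k) ≤ 1 - 1 / δ := by
  induction l with
  | nil => simpa using ⟨hp, by simpa using hx⟩
  | cons j l ih =>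
    obtain ⟨hj, hl⟩ := List.nodup_cons.1 hl
    obtain ⟨h1, h2⟩ := ih hl
    have hupd : (fun k => if k ∈ j :: l then x k + δ else x k) =
        Function.update (fun k => if k ∈ l then x k + δ else x k) j
          ((fun k => if k ∈ l then x k + δ else x k) j + δ) := by
      funext k
      by_cases hk : k = j
      · subst hk; simp [hj]
      · simp [hk]
    rw [hupd, List.foldr_cons]
    have hstep (i : σ) := h1.barrier_sub_pderiv_le hδ i j (h2 j hj)
    exact ⟨(hstep j).1, fun i hi =>
      (hstep i).2.trans (h2 i fun h => hi (List.mem_cons_of_mem j h))⟩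

end NonvanishingAbove

end MvPolynomial

/-! ### Shifts and degrees under the operators `1 - ∂ᵢ` -/

namespace MvPolynomial

variable {σ : Type*}

theorem map_foldr_sub_pderiv {R S F : Type*} [CommRing R] [CommRing S]
    [FunLike F (MvPolynomial σ R) (MvPolynomial σ S)]
    [RingHomClass F (MvPolynomial σ R) (MvPolynomial σ S)] (f : F)
    (hf : ∀ i q, f (pderiv i q) = pderiv i (f q)) (l : List σ) (p : MvPolynomial σ R) :
    f (l.foldr (fun i q => q - pderiv i q) p) = l.foldr (fun i q => q - pderiv i q) (f p) := by
  induction l with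
  | nil => rfl
  | cons j l ih => simp only [List.foldr_cons, map_sub, hf, ih]

theorem aeval_X_add_C_pderiv {R : Type*} [CommRing R] (c : R) (i : σ) (q : MvPolynomial σ R) :
    aeval (fun k => (X k + C c : MvPolynomial σ R)) (pderiv i q) =
      pderiv i (aeval (fun k => (X k + C c : MvPolynomial σ R)) q) := by
  classical
  induction q using MvPolynomial.induction_on with
  | C a => simp
  | add p q hp hq => simp only [map_add, hp, hq]
  | mul_X p k hp =>
    simp only [Derivation.leibniz, map_add, map_mul, hp, aeval_X, pderiv_X, smul_eq_mul, pderiv_C,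
      add_zero]
    by_cases hk : k = i
    · subst hk; simp
    · simp [hk]

theorem totalDegree_pderiv_le {R : Type*} [CommRing R] (i : σ) (p : MvPolynomial σ R) :
    (pderiv i p).totalDegree ≤ p.totalDegree - 1 := by
  classical
  refine Finset.sup_le fun m hm => ?_
  rw [mem_support_iff, coeff_pderiv] at hm
  have h := le_totalDegree (mem_support_iff.2 (left_ne_zero_of_mul hm))
  rw [Finsupp.sum_add_index' (fun _ => rfl) (fun _ _ _ => rfl),
    Finsupp.sum_single_index rfl] at h
  exact Nat.le_sub_of_add_le h

theorem totalDegree_foldr_sub_pderiv_sub_le {R : Type*} [CommRing R] (p : MvPolynomial σ R)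
    (l : List σ) :
    (l.foldr (fun i q => q - pderiv i q) p - p).totalDegree ≤ p.totalDegree - 1 := by
  induction l with
  | nil => simp
  | cons j l ih =>
    set q := l.foldr (fun i q => q - pderiv i q) p with hq
    have hqd : q.totalDegree ≤ p.totalDegree := by
      have := totalDegree_add (q - p) p
      rw [sub_add_cancel] at this
      exact this.trans (max_le (ih.trans (Nat.sub_le _ _)) le_rfl)
    rw [List.foldr_cons, ← hq, sub_right_comm]
    exact (totalDegree_sub _ _).trans
      (max_le ih ((totalDegree_pderiv_le j q).trans (Nat.sub_le_sub_right hqd 1)))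

end MvPolynomial

/-! ### The determinantal polynomial and its diagonal values -/

section DetPencil

open MvPolynomial

variable {d m : ℕ}

/-- The polynomial `det (∑ i, z i • A i)`. -/
noncomputable def detPencil (A : Fin m → Matrix (Fin d) (Fin d) ℂ) : MvPolynomial (Fin m) ℂ :=
  Matrix.det (∑ i, (X i : MvPolynomial (Fin m) ℂ) • (A i).map C)

theorem eval_detPencil (A : Fin m → Matrix (Fin d) (Fin d) ℂ) (z : Fin m → ℂ) :
    eval z (detPencil A) = Matrix.det (∑ i, z i • A i) := by
  rw [detPencil, RingHom.map_det]
  congr 1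
  ext a b
  simp [Matrix.sum_apply]

theorem eval_const_detPencil (A : Fin m → Matrix (Fin d) (Fin d) ℂ) (hsum : ∑ i, A i = 1)
    (t : ℂ) : eval (fun _ => t) (detPencil A) = t ^ d := by
  rw [eval_detPencil, ← Finset.smul_sum, hsum]
  simp

theorem totalDegree_detPencil_le (A : Fin m → Matrix (Fin d) (Fin d) ℂ) :
    (detPencil A).totalDegree ≤ d := by
  refine IsHomogeneous.totalDegree_le ?_
  rw [detPencil, Matrix.det_apply]
  refine IsHomogeneous.sum _ _ _ fun s _ => ?_
  have hprod : IsHomogeneous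
      (∏ k, (∑ i, (X i : MvPolynomial (Fin m) ℂ) •
        (A i).map (C : ℂ →+* MvPolynomial (Fin m) ℂ)) (s k) k) d := by
    have := IsHomogeneous.prod Finset.univ
      (fun k => (∑ i, (X i : MvPolynomial (Fin m) ℂ) •
        (A i).map (C : ℂ →+* MvPolynomial (Fin m) ℂ)) (s k) k) (fun _ => 1)
      fun k _ => by
        simp only [Matrix.sum_apply, Matrix.smul_apply, Matrix.map_apply, smul_eq_mul]
        exact IsHomogeneous.sum _ _ _ fun i _ =>
          (isHomogeneous_X ℂ i).mul (isHomogeneous_C (Fin m) _)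
    simpa using this
  rcases Int.units_eq_one_or (Equiv.Perm.sign s) with h | h
  · simpa [h] using hprod
  · simpa [h] using hprod.neg

/-- For Hermitian matrices, `det (∑ i, z i • A i)` has real coefficients. -/
theorem exists_real_detPencil (A : Fin m → Matrix (Fin d) (Fin d) ℂ)
    (hA : ∀ i, (A i).IsHermitian) :
    ∃ p : MvPolynomial (Fin m) ℝ, map Complex.ofRealHom p = detPencil A := by
  -- Conjugating the coefficients transposes the Hermitian matrices, which leaves the determinant
  -- unchanged.
  have hconj : map (starRingEnd ℂ) (detPencil A) = detPencil A := by
    rw [detPencil, RingHom.map_det, ← Matrix.det_transpose]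
    congr 1
    ext a b
    have (i : Fin m) : starRingEnd ℂ (A i b a) = A i a b := (hA i).apply a b
    simp [Matrix.sum_apply, this]
  refine mem_range_map_iff_coeffs_subset.2 fun c hc => ?_
  obtain ⟨n, -, rfl⟩ := mem_coeffs_iff.1 hc
  have := congrArg (coeff n) hconj
  rw [coeff_map] at this
  exact ⟨((detPencil A).coeff n).re, Complex.conj_eq_iff_re.1 this⟩

/-- For a kernel vector `v`, put `a i = v* (A i) v ≥ 0`, so `∑ z i * a i = 0`. Imaginary parts kill
`a i` whenever `Im (z i) > 0`; real parts kill the rest, where `z i ≥ t > 0`. But `∑ a i = v* v ≠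
0`. -/
theorem det_sum_smul_ne_zero (A : Fin m → Matrix (Fin d) (Fin d) ℂ)
    (hA : ∀ i, (A i).PosSemidef) (hsum : ∑ i, A i = 1) {t : ℝ} (ht : 0 < t) {z : Fin m → ℂ}
    (hz : z ∈ upperRegion fun _ => t) : Matrix.det (∑ i, z i • A i) ≠ 0 := by
  intro h0
  obtain ⟨v, hv, hv0⟩ := Matrix.exists_mulVec_eq_zero_iff.2 h0
  set a : Fin m → ℂ := fun i => star v ⬝ᵥ (A i).mulVec v with ha
  have ha0 (i : Fin m) : 0 ≤ (a i).re ∧ 0 = (a i).im :=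
    Complex.le_def.1 ((hA i).dotProduct_mulVec_nonneg v)
  have hlin : ∑ i, z i * a i = 0 := by
    have := congrArg (star v ⬝ᵥ ·) hv0
    simpa [Matrix.sum_mulVec, dotProduct_sum, Matrix.smul_mulVec] using this
  have hone : ∑ i, a i = star v ⬝ᵥ v := by
    simp only [ha]
    rw [← dotProduct_sum, ← Matrix.sum_mulVec, hsum, Matrix.one_mulVec]
  have him : ∑ i, (z i).im * (a i).re = 0 := by
    have := congrArg Complex.im hlin
    simpa [Complex.im_sum, Complex.mul_im, ← (ha0 _).2] using this
  have hre : ∑ i, (z i).re * (a i).re = 0 := by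
    have := congrArg Complex.re hlin
    simpa [Complex.re_sum, Complex.mul_re, ← (ha0 _).2] using this
  have him' (i : Fin m) : (z i).im * (a i).re = 0 := by
    refine (Finset.sum_eq_zero_iff_of_nonneg fun i _ => mul_nonneg ?_ (ha0 i).1).1 him i
      (Finset.mem_univ i)
    exact (hz i).elim le_of_lt fun h => h.1.ge
  have hterm (i : Fin m) : (a i).re = 0 ∨ t ≤ (z i).re :=
    (hz i).imp (fun h => (mul_eq_zero.1 (him' i)).resolve_left h.ne') And.right
  have hre' (i : Fin m) : (z i).re * (a i).re = 0 := by
    refine (Finset.sum_eq_zero_iff_of_nonneg fun i _ => ?_).1 hre i (Finset.mem_univ i)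
    rcases hterm i with h | h
    · rw [h, mul_zero]
    · exact mul_nonneg (ht.le.trans h) (ha0 i).1
  have hai (i : Fin m) : a i = 0 := by
    refine Complex.ext ?_ (ha0 i).2.symm
    rcases hterm i with h | h
    · exact h
    · exact (mul_eq_zero.1 (hre' i)).resolve_left (ht.trans_le h).ne'
  rw [Finset.sum_eq_zero fun i _ => hai i] at hone
  exact hv (dotProduct_star_self_eq_zero.1 hone.symm)

/-- With the `i`-th coordinate at `t + t * s` and the others at `t`, the determinant is `t ^ d * det
(1 + s • A i)`; differentiate at `s = 0`. -/
theorem eval_const_pderiv_detPencil (A : Fin m → Matrix (Fin d) (Fin d) ℂ)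
    (hsum : ∑ i, A i = 1) (i : Fin m) {t : ℂ} (ht : t ≠ 0) :
    eval (fun _ => t) (pderiv i (detPencil A)) = t ^ d * ((A i).trace / t) := by
  have hcomp : (slice (fun _ => t) i (detPencil A)).comp
      (Polynomial.C t + Polynomial.C t * Polynomial.X) = Polynomial.C (t ^ d) *
        Matrix.det (1 + (Polynomial.X : Polynomial ℂ) • (A i).map Polynomial.C) := by
    refine Polynomial.funext fun s => ?_
    have hmat : ∑ k, (Function.update (fun _ => t) i (t + t * s) : Fin m → ℂ) k • A k =
        t • (1 + s • A i) := by
      have (k : Fin m) : (Function.update (fun _ => t) i (t + t * s) : Fin m → ℂ) k • A k =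
          t • A k + if k = i then (t * s) • A i else 0 := by
        by_cases hk : k = i
        · subst hk; simp [add_smul]
        · simp [hk]
      rw [Finset.sum_congr rfl fun k _ => this k, Finset.sum_add_distrib, ← Finset.smul_sum, hsum,
        Finset.sum_ite_eq' Finset.univ i]
      simp [smul_smul]
    have hdet : Polynomial.eval s
        (Matrix.det (1 + (Polynomial.X : Polynomial ℂ) • (A i).map Polynomial.C)) =
        Matrix.det (1 + s • A i) := by
      rw [← Polynomial.coe_evalRingHom, RingHom.map_det]
      congr 1
      ext a b
      by_cases hab : a = b
      · subst hab; simp; ring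
      · simp [hab]; ring
    rw [Polynomial.eval_comp, eval_slice, Polynomial.eval_mul, hdet, Polynomial.eval_C]
    simp only [Polynomial.eval_add, Polynomial.eval_mul, Polynomial.eval_C, Polynomial.eval_X]
    rw [aeval_eq_eval, eval_detPencil, hmat, Matrix.det_smul, Fintype.card_fin]
  have h := congrArg (fun q => (Polynomial.derivative q).eval 0) hcomp
  simp only [Polynomial.derivative_comp, Polynomial.derivative_C_mul, Polynomial.eval_mul,
    Polynomial.eval_C, Matrix.derivative_det_one_add_X_smul, Polynomial.eval_comp,
    derivative_slice, eval_slice, Polynomial.derivative_add, Polynomial.derivative_C,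
    Polynomial.derivative_X, Polynomial.eval_add, Polynomial.eval_X, mul_zero, add_zero, zero_add,
    mul_one, Function.update_eq_self] at h
  rw [mul_div_assoc', eq_div_iff ht, mul_comm, ← h]
  rfl

theorem prod_oneSubPartial_apply (l : List (Fin m))
    (q : MvPolynomial (Fin m) (Polynomial ℂ)) :
    (l.map oneSubPartial).prod q = l.foldr (fun i q => q - pderiv i q) q := by
  induction l with
  | nil => simp
  | cons j l ih =>
    rw [List.map_cons, List.prod_cons, Module.End.mul_apply, ih, List.foldr_cons]
    rfl

theorem map_eval_mixedDet (A : Fin m → Matrix (Fin d) (Fin d) ℂ) (hsum : ∑ i, A i = 1)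
    (c : ℂ) : map (Polynomial.evalRingHom c) (mixedDet A) =
      aeval (fun k => (X k + C c : MvPolynomial (Fin m) ℂ)) (detPencil A) := by
  refine MvPolynomial.funext fun z => ?_
  have h1 : eval z (aeval (fun k => (X k + C c : MvPolynomial (Fin m) ℂ)) (detPencil A)) =
      eval (fun k => z k + c) (detPencil A) := by
    rw [← coe_aeval_eq_eval, ← coe_aeval_eq_eval, RingHom.coe_coe, RingHom.coe_coe,
      ← AlgHom.comp_apply, comp_aeval]
    simp
  rw [h1, eval_detPencil, mixedDet, RingHom.map_det, RingHom.map_det]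
  congr 1
  simp only [add_smul, Finset.sum_add_distrib]
  rw [← Finset.smul_sum, hsum, add_comm]
  ext a b
  by_cases hab : a = b
  · subst hab; simp [Matrix.sum_apply]
  · simp [Matrix.sum_apply, hab]

/-- Translation by `c` commutes with every `∂ᵢ`, so evaluating at `0` after the shift is evaluating
at `(c, …, c)`. -/
theorem eval_mixedCharPoly (A : Fin m → Matrix (Fin d) (Fin d) ℂ) (hsum : ∑ i, A i = 1)
    (c : ℂ) : (mixedCharPoly A).eval c =
      eval (fun _ => c) ((List.finRange m).foldr (fun i q => q - pderiv i q) (detPencil A)) := by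
  have h1 (q : MvPolynomial (Fin m) (Polynomial ℂ)) : (eval (fun _ => 0) q).eval c =
      eval (fun _ => 0) (map (Polynomial.evalRingHom c) q) := by
    rw [eval_map, ← Polynomial.coe_evalRingHom, eval, ← coe_eval₂Hom, ← RingHom.comp_apply]
    congr 1
    exact ringHom_ext (fun r => by simp) (fun i => by simp)
  have h2 (q : MvPolynomial (Fin m) ℂ) : eval (fun _ => c) q =
      eval (fun _ => 0) (aeval (fun k => (X k + C c : MvPolynomial (Fin m) ℂ)) q) := by
    rw [← coe_aeval_eq_eval, ← coe_aeval_eq_eval, RingHom.coe_coe, RingHom.coe_coe,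
      ← AlgHom.comp_apply, comp_aeval]
    simp
  rw [mixedCharPoly, List.ofFn_eq_map, prod_oneSubPartial_apply, h1, h2,
    map_foldr_sub_pderiv _ (fun i q => pderiv_map.symm),
    map_foldr_sub_pderiv _ (aeval_X_add_C_pderiv c), map_eval_mixedDet A hsum]

/-- The operators change `p` only in total degree below `d`, and `p` is `x ^ d` on the diagonal.
Positive degree supplies a root. -/
theorem degree_mixedCharPoly_pos (hd : 0 < d) (A : Fin m → Matrix (Fin d) (Fin d) ℂ)
    (hsum : ∑ i, A i = 1) : 0 < (mixedCharPoly A).degree := by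
  set q := (List.finRange m).foldr (fun i q => q - pderiv i q) (detPencil A) with hq
  have heval (r : MvPolynomial (Fin m) ℂ) (c : ℂ) :
      (aeval (fun _ => (Polynomial.X : Polynomial ℂ)) r).eval c = eval (fun _ => c) r := by
    induction r using MvPolynomial.induction_on with
    | C a => simp
    | add p q hp hq => simp only [map_add, Polynomial.eval_add, hp, hq]
    | mul_X p k hp => simp [hp]
  have hμ : mixedCharPoly A =
      Polynomial.X ^ d + aeval (fun _ => (Polynomial.X : Polynomial ℂ)) (q - detPencil A) := by
    refine Polynomial.funext fun c => ?_
    rw [eval_mixedCharPoly A hsum, Polynomial.eval_add, heval, map_sub,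
      eval_const_detPencil A hsum]
    simp [hq]
  have hdeg : (aeval (fun _ => (Polynomial.X : Polynomial ℂ)) (q - detPencil A)).natDegree < d := by
    have := aeval_natDegree_le (q - detPencil A)
      ((totalDegree_foldr_sub_pderiv_sub_le (detPencil A) (List.finRange m)).trans
        (Nat.sub_le_sub_right (totalDegree_detPencil_le A) 1))
      (fun _ => (Polynomial.X : Polynomial ℂ)) (n := 1) (fun _ => Polynomial.natDegree_X_le)
    omega
  rw [← Polynomial.natDegree_pos_iff_degree_pos, hμ,
    Polynomial.natDegree_add_eq_left_of_natDegree_lt (by rwa [Polynomial.natDegree_X_pow]),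
    Polynomial.natDegree_X_pow]
  exact hd

end DetPencil

/-! ### The root bound -/

open MvPolynomial in
theorem mixedCharPoly_eval_ne_zero {d m : ℕ} (hd : 0 < d)
    (A : Fin m → Matrix (Fin d) (Fin d) ℂ) (ε : ℝ) (hA : ∀ i, (A i).PosSemidef)
    (hsum : ∑ i, A i = 1) (htr : ∀ i, (A i).trace.re ≤ ε) {w : ℂ}
    (hw : w.im ≠ 0 ∨ (1 + Real.sqrt ε) ^ 2 ≤ w.re) : (mixedCharPoly A).eval w ≠ 0 := by
  -- The traces sum to `d > 0`, so their common bound must be positive.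
  have hε : 0 < ε := by
    by_contra hle
    have h1 : (∑ i, (A i).trace).re = d := by
      rw [← Matrix.trace_sum, hsum, Matrix.trace_one]; simp
    rw [Complex.re_sum] at h1
    have h2 : ∑ i, (A i).trace.re ≤ 0 :=
      Finset.sum_nonpos fun i _ => (htr i).trans (not_lt.1 hle)
    rw [h1] at h2
    exact absurd hd (by exact_mod_cast not_lt.2 h2)
  obtain ⟨p, hp⟩ := exists_real_detPencil A fun i => (hA i).1
  have hpz (q : MvPolynomial (Fin m) ℝ) (z : Fin m → ℂ) :
      aeval z q = eval z (map Complex.ofRealHom q) := by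
    rw [eval_map]; rfl
  set s := Real.sqrt ε with hs
  have hs0 : 0 < s := Real.sqrt_pos.2 hε
  have hss : s * s = ε := Real.mul_self_sqrt hε.le
  -- Chosen so that `ε / t = 1 - 1 / (1 + s)`.
  set t := s + ε with ht_def
  have ht : 0 < t := by positivity
  have hnv : NonvanishingAbove p fun _ => t := fun z hz => by
    rw [hpz, hp, eval_detPencil]
    exact det_sum_smul_ne_zero A hA hsum ht hz
  have hbar (i : Fin m) : barrier p i (fun _ => t) ≤ 1 - 1 / (1 + s) := by
    have htC : (t : ℂ) ≠ 0 := by exact_mod_cast ht.ne'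
    have h1 : ((barrier p i fun _ => t : ℝ) : ℂ) = (A i).trace / t := by
      rw [barrier, Complex.ofReal_div, ← aeval_ofReal, ← aeval_ofReal, hpz, hpz, ← pderiv_map, hp,
        eval_const_pderiv_detPencil A hsum i htC, eval_const_detPencil A hsum,
        mul_div_cancel_left₀ _ (pow_ne_zero d htC)]
    have h2 : barrier p i (fun _ => t) = (A i).trace.re / t := by
      have := congrArg Complex.re h1
      rwa [Complex.ofReal_re, Complex.div_ofReal_re] at this
    rw [h2, div_le_iff₀ ht]
    refine (htr i).trans (le_of_eq ?_)
    rw [ht_def, ← hss]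
    field_simp
    ring
  have hT : t + (1 + s) = (1 + s) ^ 2 := by rw [ht_def, ← hss]; ring
  have hfold := (hnv.foldr_sub_pderiv (δ := 1 + s) (by positivity) hbar (List.finRange m)
    (List.nodup_finRange m)).1
  simp only [List.mem_finRange, if_true, hT] at hfold
  set q := (List.finRange m).foldr (fun i q => q - pderiv i q) p with hq
  have hμ (w : ℂ) : (mixedCharPoly A).eval w = aeval (fun _ => w) q := by
    rw [eval_mixedCharPoly A hsum, hpz, hq,
      map_foldr_sub_pderiv _ (fun i q => pderiv_map.symm), hp]
  have hupper {w : ℂ} (hw : 0 < w.im ∨ (w.im = 0 ∧ (1 + s) ^ 2 ≤ w.re)) :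
      (mixedCharPoly A).eval w ≠ 0 := by
    rw [hμ]
    exact hfold _ fun _ => hw
  -- The region covers only the upper half plane; the lower one follows by conjugation, as `q` is
  -- real.
  rcases lt_trichotomy w.im 0 with hlt | h0 | hgt
  · have hconj : starRingEnd ℂ ((mixedCharPoly A).eval w) =
        (mixedCharPoly A).eval (starRingEnd ℂ w) := by
      rw [hμ, hμ]
      exact (comp_aeval_apply (fun _ => w) (Complex.conjAe : ℂ →ₐ[ℝ] ℂ) q)
    intro h
    rw [h, map_zero] at hconj
    exact hupper (w := starRingEnd ℂ w) (Or.inl (by simpa using hlt)) hconj.symm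
  · exact hupper (Or.inr ⟨h0, hw.resolve_left (not_not.2 h0)⟩)
  · exact hupper (Or.inl hgt)

theorem mainTheorem1 {d m : ℕ} (hd : 0 < d) (A : Fin m → Matrix (Fin d) (Fin d) ℂ) (ε : ℝ)
    (hA : ∀ i, (A i).PosSemidef) (hsum : ∑ i, A i = 1) (htr : ∀ i, (A i).trace.re ≤ ε) :
    (∀ z : ℂ, (mixedCharPoly A).IsRoot z → z.im = 0) ∧
      ∃ r : ℝ, IsGreatest {x : ℝ | (mixedCharPoly A).IsRoot (x : ℂ)} r ∧
        r ≤ (1 + Real.sqrt ε) ^ 2 := by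
  have hne {w : ℂ} := mixedCharPoly_eval_ne_zero hd A ε hA hsum htr (w := w)
  have hreal (z : ℂ) (hz : (mixedCharPoly A).IsRoot z) : z.im = 0 := by
    by_contra h
    exact hne (Or.inl h) hz
  refine ⟨hreal, ?_⟩
  have hdeg := degree_mixedCharPoly_pos hd A hsum
  have hfin : {x : ℝ | (mixedCharPoly A).IsRoot (x : ℂ)}.Finite :=
    (Polynomial.finite_setOfPred_isRoot (Polynomial.ne_zero_of_degree_gt hdeg)).preimage
      Complex.ofReal_injective.injOn
  have hnonempty : {x : ℝ | (mixedCharPoly A).IsRoot (x : ℂ)}.Nonempty := by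
    obtain ⟨z, hz⟩ := Complex.exists_root hdeg
    refine ⟨z.re, ?_⟩
    have : ((z.re : ℝ) : ℂ) = z := Complex.ext (by simp) (by simp [hreal z hz])
    rwa [Set.mem_ofPred_eq, this]
  obtain ⟨r, hr, hmax⟩ := Set.exists_max_image _ id hfin hnonempty
  refine ⟨r, ⟨hr, hmax⟩, ?_⟩
  by_contra hlt
  exact hne (w := r) (Or.inr (not_le.1 hlt).le) hr
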